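/- Let $(\Omega,\mathcal F,\mathbb P)$ be a probability space and let $\theta:\Omega\to\Omega$ be a bi-measurable bijection that preserves $\mathbb P$ and is ergodic. Let $\sigma,\tau$ be integrable real random variables with $\sigma\ge 0$ and $\tau>0$ almost surely; $\sigma\circ\theta^n$ is the service time of customer $n\in\mathbb Z$ and $\tau\circ\theta^n$ is the time between the arrivals of customers $n$ and $n+1$. For $\ell\ge 1$ put $$Z_\ell=\Bigl[\sup_{k\ge \ell}\Bigl(\sigma\circ\theta^{-k}-\sum_{i=1}^k\tau\circ\theta^{-i}\Bigr)\Bigr]^+ .$$ Let $p\ge 1$ be an integer and let $E_p=\{u\in\mathbb R^p:\ 0\le u(1)\le\dots\le u(p)\}$. The loss system with $p$ servers is driven by the random map $$H^p:E_p\to E_p,\qquad H^p(u)=\overline{\bigl[u+\sigma\,\mathbf 1_{\{u(1)=0\}}\,\mathbf e_1-\tau\,(1,\dots,1)\bigr]^+},$$ where $[\cdot]^+$ is the coordinatewise positive part, $\mathbf e_1=(1,0,\dots,0)$, and $\overline{v}$ is the increasing reordering of the coordinates of $v$. Assume that the input is GI/GI, that is, $(\sigma\circ\theta^n)_{n\in\mathbb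 Z}$ and $(\tau\circ\theta^n)_{n\in\mathbb Z}$ are mutually independent i.i.d. sequences, that the distribution of $\tau$ has unbounded support, and that $\mathbb P(Z_p=0)>0$. Then the equation $$U\circ\theta=H^p(U)\quad\mathbb P\text{-almost surely}$$ has a (finite) $E_p$-valued random variable $U^p$ as a solution, every $E_p$-valued random variable that solves it is equal to $U^p$ almost surely, and almost surely $U^p(i)\le Z_{p+1-i}$ for all $i\in\{1,\dots,p\}$, that is, $U^p$ is bounded coordinatewise by $(Z_p,Z_{p-1},\dots,Z_1)$. -/

import Mathlib

open MeasureTheory ProbabilityTheory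

namespace LossSystem

/-- The set of fully ordered vectors `0 ≤ u(1) ≤ ... ≤ u(p)`, as a subtype of `ℝ^p`
(coordinates are indexed from `0` to `p - 1`), with the induced Borel `σ`-algebra. -/
abbrev OrderedVec (p : ℕ) : Type :=
  {u : Fin p → ℝ // Monotone u ∧ ∀ i, 0 ≤ u i}

/-- The vector `[u + s 1_{u(1) = 0} e₁ - t 𝟏]⁺`, before reordering. -/
noncomputable def preLossMap {p : ℕ} [NeZero p] (s t : ℝ) (u : Fin p → ℝ) : Fin p → ℝ :=
  fun i => max (u i + (if u 0 = 0 then s else 0) * (Pi.single 0 1 : Fin p → ℝ) i - t) 0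

/-- The driving map of the loss system with `p` servers, for a service time `s` and an
inter-arrival time `t`: the increasing reordering of `[u + s 1_{u(1) = 0} e₁ - t 𝟏]⁺`. -/
noncomputable def lossMap {p : ℕ} [NeZero p] (s t : ℝ) (u : OrderedVec p) : OrderedVec p :=
  ⟨preLossMap s t u.1 ∘ Tuple.sort (preLossMap s t u.1),
    Tuple.monotone_sort _, fun _ => le_max_right _ _⟩

variable {Ω : Type*} [MeasurableSpace Ω]

/-- The iterate `θ^n`, `n ∈ ℤ`, of the bijective shift `θ`. -/
def shift (θ : Ω ≃ᵐ Ω) (n : ℤ) (ω : Ω) : Ω :=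
  ((θ.toEquiv : Equiv.Perm Ω) ^ n) ω

/-- The extended real random variable
`Z_ℓ = [sup_{k ≥ ℓ} (σ ∘ θ^{-k} - ∑_{i=1}^k τ ∘ θ^{-i})]⁺`. -/
noncomputable def Z (θ : Ω ≃ᵐ Ω) (σ τ : Ω → ℝ) (ℓ : ℕ) (ω : Ω) : EReal :=
  max (⨆ (k : ℕ) (_ : ℓ ≤ k),
    ((σ (shift θ (-(k : ℤ)) ω) - ∑ i ∈ Finset.Icc 1 k, τ (shift θ (-(i : ℤ)) ω) : ℝ) : EReal)) 0

/-- An independent and identically distributed sequence of real random variables. -/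
def IsIID (P : Measure Ω) (X : ℤ → Ω → ℝ) : Prop :=
  iIndepFun X P ∧ ∀ m n, IdentDistrib (X m) (X n) P P

/-- GI/GI input: the service times `σ ∘ θ^n` and the inter-arrival times `τ ∘ θ^n` form
mutually independent i.i.d. sequences. -/
def IsGIGI (P : Measure Ω) (θ : Ω ≃ᵐ Ω) (σ τ : Ω → ℝ) : Prop :=
  IsIID P (fun n ω => σ (shift θ n ω)) ∧
  IsIID P (fun n ω => τ (shift θ n ω)) ∧
  IndepFun (fun ω (n : ℤ) => σ (shift θ n ω)) (fun ω (n : ℤ) => τ (shift θ n ω)) P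

/-- `U` is a (finite) stationary service profile of the loss system with `p` servers: a random
variable with values in the ordered vectors such that `U ∘ θ = H^p(U)` almost surely. -/
def IsStationarySolution {p : ℕ} [NeZero p] (P : Measure Ω) (θ : Ω ≃ᵐ Ω) (σ τ : Ω → ℝ)
    (U : Ω → OrderedVec p) : Prop :=
  Measurable U ∧ ∀ᵐ ω ∂P, U (θ ω) = lossMap (σ ω) (τ ω) (U ω)

end LossSystem

open Filter

namespace LossSystem

section Deterministic

variable {p : ℕ} [NeZero p]

theorem lossMap_apply_le_iff {s t c : ℝ} {u : OrderedVec p} {i : Fin p} :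
    (lossMap s t u).1 i ≤ c ↔
      (i : ℕ) < (Finset.univ.filter fun j => preLossMap s t u.1 j ≤ c).card := by
  rw [← Tuple.lt_card_le_iff_apply_le_of_monotone (lossMap s t u).2.1]
  have : (Finset.univ.filter fun j => (lossMap s t u).1 j ≤ c).card =
      (Finset.univ.filter fun j => preLossMap s t u.1 j ≤ c).card :=
    Finset.card_equiv (Tuple.sort (preLossMap s t u.1)) fun j =>
      by simp only [Finset.mem_filter, Finset.mem_univ, true_and]; rfl
  rw [this]

theorem preLossMap_of_ne_zero (s t : ℝ) (u : Fin p → ℝ) {j : Fin p} (hj : j ≠ 0) :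
    preLossMap s t u j = max (u j - t) 0 := by
  simp [preLossMap, hj]

/-- Below the top, the `i`-th coordinate after one step is controlled by the next one before it. -/
theorem lossMap_apply_le_next (s t : ℝ) (u : OrderedVec p) {i j : Fin p}
    (hij : (j : ℕ) = i + 1) : (lossMap s t u).1 i ≤ max (u.1 j - t) 0 := by
  rw [lossMap_apply_le_iff]
  have hsub : Finset.Ioc 0 j ⊆
      Finset.univ.filter fun k => preLossMap s t u.1 k ≤ max (u.1 j - t) 0 := by
    intro k hk
    rw [Finset.mem_Ioc] at hk
    have := u.2.1 hk.2
    simp only [Finset.mem_filter, Finset.mem_univ, true_and,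
      preLossMap_of_ne_zero s t u.1 hk.1.ne']
    gcongr
  refine lt_of_lt_of_le ?_ (Finset.card_le_card hsub)
  rw [Fin.card_Ioc]
  simp [hij]

theorem lossMap_apply_le {s t c : ℝ} {u : OrderedVec p} (hc : 0 ≤ c) (hs : s - t ≤ c)
    (hu : ∀ j, u.1 j - t ≤ c) (i : Fin p) : (lossMap s t u).1 i ≤ c := by
  suffices h : ∀ j, preLossMap s t u.1 j ≤ c from h _
  intro j
  refine max_le ?_ hc
  rcases eq_or_ne j 0 with rfl | hj
  · by_cases h0 : u.1 0 = 0
    · simpa [h0] using hs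
    · simpa [h0] using hu 0
  · simpa [hj] using hu j

theorem measurable_lossMap {α : Type*} [MeasurableSpace α] {s t : α → ℝ} {u : α → OrderedVec p}
    (hs : Measurable s) (ht : Measurable t) (hu : Measurable u) :
    Measurable fun a => lossMap (s a) (t a) (u a) := by
  classical
  have hu' (i : Fin p) : Measurable fun a => (u a).1 i :=
    (measurable_pi_apply i).comp (measurable_subtype_coe.comp hu)
  have hpre (i : Fin p) : Measurable fun a => preLossMap (s a) (t a) (u a).1 i := by
    have hite : Measurable fun a => if (u a).1 0 = 0 then s a else 0 :=
      Measurable.ite (hu' 0 (measurableSet_singleton 0)) hs measurable_const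
    exact (((hu' i).add (hite.mul_const _)).sub ht).max measurable_const
  refine Measurable.subtype_mk (f := fun a => (lossMap (s a) (t a) (u a)).1) ?_
  refine measurable_pi_lambda _ fun i => measurable_of_Iic fun c => ?_
  have hcard : Measurable fun a =>
      (Finset.univ.filter fun j => preLossMap (s a) (t a) (u a).1 j ≤ c).card := by
    simp only [Finset.card_filter]
    exact Finset.measurable_fun_sum _ fun j _ =>
      Measurable.ite (hpre j measurableSet_Iic) measurable_const measurable_const
  have : (fun a => (lossMap (s a) (t a) (u a)).1 i) ⁻¹' Set.Iic c =
      (fun a => (Finset.univ.filter fun j => preLossMap (s a) (t a) (u a).1 j ≤ c).card) ⁻¹'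
        Set.Ioi (i : ℕ) := by
    ext a
    exact lossMap_apply_le_iff
  rw [this]
  exact hcard measurableSet_Ioi

instance {p : ℕ} : Zero (OrderedVec p) := ⟨⟨0, monotone_const, fun _ => le_rfl⟩⟩

theorem orderedVec_eq_zero {p : ℕ} {u : OrderedVec p} (h : ∀ i, u.1 i ≤ 0) : u = 0 :=
  Subtype.ext (funext fun i => le_antisymm (h i) (u.2.2 i))

end Deterministic

section Shift

variable {Ω : Type*} [MeasurableSpace Ω] (θ : Ω ≃ᵐ Ω)

@[simp] theorem shift_zero (ω : Ω) : shift θ 0 ω = ω := rfl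

theorem shift_add (m n : ℤ) (ω : Ω) : shift θ (m + n) ω = shift θ m (shift θ n ω) := by
  simp [shift, zpow_add]

@[simp] theorem shift_one (ω : Ω) : shift θ 1 ω = θ ω := by simp [shift]

theorem apply_shift (n : ℤ) (ω : Ω) : θ (shift θ n ω) = shift θ (n + 1) ω := by
  rw [add_comm, shift_add, shift_one]

theorem shift_apply (n : ℤ) (ω : Ω) : shift θ n (θ ω) = shift θ (n + 1) ω := by
  rw [shift_add, shift_one]

theorem shift_natCast (n : ℕ) (ω : Ω) : shift θ n ω = θ^[n] ω := by
  induction n with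
  | zero => rfl
  | succ n ih => rw [Function.iterate_succ_apply', ← ih, apply_shift]; push_cast; rfl

theorem shift_neg_natCast (n : ℕ) (ω : Ω) : shift θ (-(n : ℤ)) ω = θ.symm^[n] ω := by
  induction n with
  | zero => rfl
  | succ n ih =>
    rw [Function.iterate_succ_apply', ← ih, MeasurableEquiv.eq_symm_apply, apply_shift]
    congr 1
    push_cast
    ring

variable {θ}

theorem shift_neg_add (n k : ℕ) (ω : Ω) :
    shift θ (-(k : ℤ)) (shift θ (-(n : ℤ)) ω) = shift θ (-((n + k : ℕ) : ℤ)) ω := by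
  rw [← shift_add]
  congr 1
  push_cast
  ring

theorem shift_neg_succ_apply (n : ℕ) (ω : Ω) :
    shift θ (-((n + 1 : ℕ) : ℤ)) (θ ω) = shift θ (-(n : ℤ)) ω := by
  rw [shift_apply]
  congr 1
  push_cast
  ring

theorem apply_shift_neg_succ (n : ℕ) (ω : Ω) :
    θ (shift θ (-((n + 1 : ℕ) : ℤ)) ω) = shift θ (-(n : ℤ)) ω := by
  rw [apply_shift, ← shift_apply, shift_neg_succ_apply]

theorem measurePreserving_shift {P : Measure Ω} (hθ : MeasurePreserving θ P P) (n : ℤ) :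
    MeasurePreserving (shift θ n) P P := by
  obtain ⟨k, rfl | rfl⟩ := n.eq_nat_or_neg
  · rw [funext (shift_natCast θ k)]
    exact hθ.iterate k
  · rw [funext (shift_neg_natCast θ k)]
    exact (MeasurePreserving.symm θ hθ).iterate k

theorem measurable_shift (n : ℤ) : Measurable (shift θ n) := by
  obtain ⟨k, rfl | rfl⟩ := n.eq_nat_or_neg
  · rw [funext (shift_natCast θ k)]
    exact θ.measurable.iterate k
  · rw [funext (shift_neg_natCast θ k)]
    exact θ.symm.measurable.iterate k

theorem ae_forall_shift {P : Measure Ω} (hθ : MeasurePreserving θ P P) {q : Ω → Prop}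
    (hq : ∀ᵐ ω ∂P, q ω) : ∀ᵐ ω ∂P, ∀ n, q (shift θ n ω) :=
  ae_all_iff.2 fun n => (measurePreserving_shift hθ n).quasiMeasurePreserving.ae hq

/-- Poincaré recurrence for ergodic maps: almost every orbit visits a given set of positive
measure infinitely often. -/
theorem ae_frequently_iterate_mem {μ : Measure Ω} [IsFiniteMeasure μ] {f : Ω → Ω}
    (hf : Ergodic f μ) {s : Set Ω} (hs : MeasurableSet s) (hs0 : μ s ≠ 0) :
    ∀ᵐ x ∂μ, ∃ᶠ n in atTop, f^[n] x ∈ s := by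
  have hm : MeasurableSet {x | ∃ᶠ n in atTop, f^[n] x ∈ s} :=
    MeasurableSet.measurableSet_limsup (s := fun n => f^[n] ⁻¹' s)
      (fun n => hf.measurable.iterate n hs) |> fun h => by
        convert! h using 1
        ext x
        simp [mem_limsup_iff_frequently_mem]
  have hinv : f ⁻¹' {x | ∃ᶠ n in atTop, f^[n] x ∈ s} = {x | ∃ᶠ n in atTop, f^[n] x ∈ s} := by
    ext x
    simp only [Set.mem_preimage, Set.mem_ofPred_eq, ← Function.iterate_succ_apply]
    conv_rhs => rw [← map_add_atTop_eq_nat 1, frequently_map]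
  rcases hf.toPreErgodic.ae_mem_or_ae_notMem hm hinv with h | h
  · exact h
  · refine absurd ?_ hs0
    rw [measure_eq_zero_iff_ae_notMem]
    filter_upwards [h,
      hf.toMeasurePreserving.conservative.ae_mem_imp_frequently_image_mem hs.nullMeasurableSet]
      with x hx hx' hxs using hx (hx' hxs)

theorem ae_frequently_shift_neg_mem {P : Measure Ω} [IsFiniteMeasure P] (hθ : Ergodic θ P)
    {s : Set Ω} (hs : MeasurableSet s) (hs0 : P s ≠ 0) :
    ∀ᵐ ω ∂P, ∃ᶠ n : ℕ in atTop, shift θ (-(n : ℤ)) ω ∈ s := by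
  simp only [shift_neg_natCast]
  exact ae_frequently_iterate_mem hθ.symm hs hs0

/-- Backward sums of a nonnegative function along an ergodic orbit diverge, as soon as the
function exceeds `1` with positive probability. -/
theorem ae_tendsto_sum_shift_neg {P : Measure Ω} [IsFiniteMeasure P] (hθ : Ergodic θ P)
    {τ : Ω → ℝ} (hτm : Measurable τ) (hτ0 : ∀ᵐ ω ∂P, 0 ≤ τ ω) (hτ1 : P {ω | 1 < τ ω} ≠ 0) :
    ∀ᵐ ω ∂P, Tendsto (fun n : ℕ => ∑ i ∈ Finset.Icc 1 n, τ (shift θ (-(i : ℤ)) ω))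
      atTop atTop := by
  filter_upwards [ae_frequently_shift_neg_mem hθ (hτm measurableSet_Ioi) hτ1,
    ae_forall_shift hθ.toMeasurePreserving hτ0] with ω hfreq hpos
  have hmono : Monotone fun n : ℕ => ∑ i ∈ Finset.Icc 1 n, τ (shift θ (-(i : ℤ)) ω) :=
    fun m n hmn => Finset.sum_le_sum_of_subset_of_nonneg (Finset.Icc_subset_Icc_right hmn)
      fun i _ _ => hpos _
  have hnat (k : ℕ) : ∃ n : ℕ, (k : ℝ) ≤ ∑ i ∈ Finset.Icc 1 n, τ (shift θ (-(i : ℤ)) ω) := by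
    induction k with
    | zero => exact ⟨0, by simp⟩
    | succ k ih =>
      obtain ⟨n, hn⟩ := ih
      obtain ⟨m, hm, hmτ⟩ := frequently_atTop.1 hfreq (n + 1)
      obtain ⟨m, rfl⟩ := Nat.exists_eq_add_of_le' (show 1 ≤ m by omega)
      refine ⟨m + 1, ?_⟩
      rw [Finset.sum_Icc_succ_top (by omega)]
      have h1 := hn.trans (hmono (show n ≤ m by omega))
      have h2 : 1 < τ (shift θ (-((m + 1 : ℕ) : ℤ)) ω) := hmτ
      push_cast at h2 ⊢
      linarith
  refine tendsto_atTop_atTop_of_monotone hmono fun b => ?_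
  obtain ⟨n, hn⟩ := hnat ⌈b⌉₊
  exact ⟨n, (Nat.le_ceil b).trans hn⟩

end Shift

section Bounds

variable {Ω : Type*} [MeasurableSpace Ω] (θ : Ω ≃ᵐ Ω) (σ τ : Ω → ℝ)

/-- The signed residual service time, at time `0`, of customer `-k`. -/
noncomputable def residual (k : ℕ) (ω : Ω) : ℝ :=
  σ (shift θ (-(k : ℤ)) ω) - ∑ i ∈ Finset.Icc 1 k, τ (shift θ (-(i : ℤ)) ω)

theorem residual_succ_apply (k : ℕ) (ω : Ω) :
    residual θ σ τ (k + 1) (θ ω) = residual θ σ τ k ω - τ ω := by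
  have hsum : ∑ i ∈ Finset.Icc 1 (k + 1), τ (shift θ (-(i : ℤ)) (θ ω)) =
      τ ω + ∑ i ∈ Finset.Icc 1 k, τ (shift θ (-(i : ℤ)) ω) := by
    induction k with
    | zero => simp [shift_apply]
    | succ k ih =>
      rw [Finset.sum_Icc_succ_top (by omega), ih, Finset.sum_Icc_succ_top (by omega : 1 ≤ k + 1),
        shift_neg_succ_apply, add_assoc]
  rw [residual, residual, hsum, shift_neg_succ_apply]
  ring

variable {θ σ τ}

theorem measurable_residual (hσ : Measurable σ) (hτ : Measurable τ) (k : ℕ) :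
    Measurable (residual θ σ τ k) :=
  (hσ.comp (measurable_shift _)).sub
    (Finset.measurable_fun_sum _ fun _ _ => hτ.comp (measurable_shift _))

theorem Z_nonneg (ℓ : ℕ) (ω : Ω) : 0 ≤ Z θ σ τ ℓ ω := le_max_right _ _

theorem residual_le_Z {ℓ k : ℕ} (h : ℓ ≤ k) (ω : Ω) :
    (residual θ σ τ k ω : EReal) ≤ Z θ σ τ ℓ ω :=
  (le_iSup₂ (f := fun (k : ℕ) (_ : ℓ ≤ k) => (residual θ σ τ k ω : EReal)) k h).trans
    (le_max_left _ _)

theorem Z_le {ℓ : ℕ} {ω : Ω} {c : EReal} (hc : 0 ≤ c)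
    (h : ∀ k, ℓ ≤ k → (residual θ σ τ k ω : EReal) ≤ c) : Z θ σ τ ℓ ω ≤ c :=
  max_le (iSup₂_le h) hc

theorem Z_antitone (ω : Ω) : Antitone fun ℓ => Z θ σ τ ℓ ω :=
  fun _ _ h => Z_le (Z_nonneg _ _) fun _ hk => residual_le_Z (h.trans hk) ω

theorem Z_eq_zero_iff {ℓ : ℕ} {ω : Ω} :
    Z θ σ τ ℓ ω = 0 ↔ ∀ k, ℓ ≤ k → residual θ σ τ k ω ≤ 0 := by
  refine ⟨fun h k hk => ?_, fun h => le_antisymm (Z_le le_rfl fun k hk => ?_) (Z_nonneg _ _)⟩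
  · exact_mod_cast (residual_le_Z hk ω).trans h.le
  · exact_mod_cast h k hk

theorem measurableSet_Z_eq_zero (hσ : Measurable σ) (hτ : Measurable τ) (ℓ : ℕ) :
    MeasurableSet {ω | Z θ σ τ ℓ ω = 0} := by
  simp only [Z_eq_zero_iff, Set.ofPred_forall]
  exact .iInter fun k => .iInter fun _ => measurable_residual hσ hτ k measurableSet_Iic

/-- One-step recursion (lower bound) for the family `Z`. -/
theorem sub_le_Z_succ {ℓ : ℕ} {ω : Ω} {x : ℝ} (hτ : 0 ≤ τ ω) (hx : (x : EReal) ≤ Z θ σ τ ℓ ω) :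
    ((x - τ ω : ℝ) : EReal) ≤ Z θ σ τ (ℓ + 1) (θ ω) := by
  have key : Z θ σ τ ℓ ω ≤ Z θ σ τ (ℓ + 1) (θ ω) + (τ ω : EReal) := by
    refine Z_le (add_nonneg (Z_nonneg _ _) (by exact_mod_cast hτ)) fun k hk => ?_
    have h : residual θ σ τ k ω = residual θ σ τ (k + 1) (θ ω) + τ ω := by
      rw [residual_succ_apply]; ring
    rw [h, EReal.coe_add]
    gcongr
    exact residual_le_Z (by omega) _
  rw [EReal.coe_sub]
  exact EReal.sub_le_of_le_add (hx.trans key)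

/-- The profile `u` is bounded coordinatewise by `(Z_p, ..., Z_1)` at `ω`. -/
def DominatedByZ {p : ℕ} (θ : Ω ≃ᵐ Ω) (σ τ : Ω → ℝ) (ω : Ω) (u : OrderedVec p) : Prop :=
  ∀ i : Fin p, (u.1 i : EReal) ≤ Z θ σ τ (p - (i : ℕ)) ω

theorem dominatedByZ_zero {p : ℕ} (ω : Ω) : DominatedByZ θ σ τ ω (0 : OrderedVec p) :=
  fun _ => Z_nonneg _ _

theorem DominatedByZ.le_Z_one {p : ℕ} {ω : Ω} {u : OrderedVec p} (h : DominatedByZ θ σ τ ω u)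
    (i : Fin p) : (u.1 i : EReal) ≤ Z θ σ τ 1 ω :=
  (h i).trans (Z_antitone ω (show 1 ≤ p - (i : ℕ) by omega))

variable {p : ℕ} [NeZero p]

theorem lossMap_le_max_Z_one {ω : Ω} (hτ : 0 ≤ τ ω) {u : OrderedVec p} {c : ℝ}
    (hu : ∀ j, (u.1 j : EReal) ≤ max (Z θ σ τ 1 ω) c) (i : Fin p) :
    ((lossMap (σ ω) (τ ω) u).1 i : EReal) ≤ max (Z θ σ τ 1 (θ ω)) ((c - τ ω : ℝ) : EReal) := by
  set b := max (Z θ σ τ 1 (θ ω)) ((c - τ ω : ℝ) : EReal)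
  have hb0 : (0 : EReal) ≤ b := (Z_nonneg _ _).trans (le_max_left _ _)
  rcases eq_or_ne b ⊤ with htop | htop
  · rw [htop]; exact le_top
  have hb : ((b.toReal : ℝ) : EReal) = b :=
    EReal.coe_toReal htop (ne_of_gt (lt_of_lt_of_le EReal.bot_lt_zero hb0))
  rw [← hb, EReal.coe_le_coe_iff]
  refine lossMap_apply_le (EReal.toReal_nonneg hb0) ?_ (fun j => ?_) i
  · rw [← EReal.coe_le_coe_iff, hb]
    refine le_trans ?_ (le_max_left _ _)
    have h := residual_le_Z (θ := θ) (σ := σ) (τ := τ) (le_refl 1) (θ ω)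
    rw [show (1 : ℕ) = 0 + 1 from rfl, residual_succ_apply] at h
    simpa [residual] using h
  · rw [← EReal.coe_le_coe_iff, hb]
    rcases le_max_iff.1 (hu j) with h | h
    · exact ((sub_le_Z_succ hτ h).trans (Z_antitone _ (Nat.le_succ 1))).trans (le_max_left _ _)
    · refine le_trans ?_ (le_max_right _ _)
      rw [EReal.coe_le_coe_iff] at h ⊢
      linarith

theorem DominatedByZ.lossMap {ω : Ω} (hτ : 0 ≤ τ ω) {u : OrderedVec p}
    (h : DominatedByZ θ σ τ ω u) : DominatedByZ θ σ τ (θ ω) (lossMap (σ ω) (τ ω) u) := by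
  intro i
  rcases Nat.lt_or_ge (i + 1) p with hi | hi
  · have h1 := lossMap_apply_le_next (σ ω) (τ ω) u (i := i) (j := ⟨i + 1, hi⟩) rfl
    have h2 := sub_le_Z_succ hτ (h ⟨i + 1, hi⟩)
    rw [show p - (i + 1 : ℕ) + 1 = p - i by omega] at h2
    refine (EReal.coe_le_coe_iff.2 h1).trans ?_
    rcases max_choice (u.1 ⟨i + 1, hi⟩ - τ ω) 0 with h | h <;> rw [h]
    · exact h2
    · exact Z_nonneg _ _
  · rw [show p - (i : ℕ) = 1 by omega]
    refine (lossMap_le_max_Z_one (c := 0) hτ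
      (fun j => (h.le_Z_one j).trans (le_max_left _ _)) i).trans (max_le le_rfl ?_)
    refine le_trans ?_ (Z_nonneg _ _)
    rw [zero_sub]
    exact_mod_cast neg_nonpos.2 hτ

end Bounds

section Loynes

variable {Ω : Type*} [MeasurableSpace Ω] {p : ℕ} [NeZero p]

/-- The profile at time `0` of the loss system started at time `-n` from the profile `v`. -/
noncomputable def loynesState (θ : Ω ≃ᵐ Ω) (σ τ : Ω → ℝ) (ω : Ω) :
    ℕ → OrderedVec p → OrderedVec p
  | 0, v => v
  | n + 1, v => loynesState θ σ τ ω n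
      (lossMap (σ (shift θ (-((n + 1 : ℕ) : ℤ)) ω)) (τ (shift θ (-((n + 1 : ℕ) : ℤ)) ω)) v)

variable {θ : Ω ≃ᵐ Ω} {σ τ : Ω → ℝ}

theorem loynesState_add (ω : Ω) (n k : ℕ) (v : OrderedVec p) :
    loynesState θ σ τ ω (n + k) v =
      loynesState θ σ τ ω n (loynesState θ σ τ (shift θ (-(n : ℤ)) ω) k v) := by
  induction k generalizing v with
  | zero => rfl
  | succ k ih =>
    rw [← add_assoc, loynesState, ih, loynesState, shift_neg_add, add_assoc]

theorem loynesState_succ_apply (ω : Ω) (n : ℕ) (v : OrderedVec p) :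
    loynesState θ σ τ (θ ω) (n + 1) v = lossMap (σ ω) (τ ω) (loynesState θ σ τ ω n v) := by
  induction n generalizing v with
  | zero => simp [loynesState, shift_apply]
  | succ n ih => rw [loynesState, ih, shift_neg_succ_apply, loynesState]

theorem measurable_loynesState (hσ : Measurable σ) (hτ : Measurable τ) (n : ℕ)
    {v : Ω → OrderedVec p} (hv : Measurable v) :
    Measurable fun ω => loynesState θ σ τ ω n (v ω) := by
  induction n generalizing v with
  | zero => exact hv
  | succ n ih =>
    exact ih (measurable_lossMap (hσ.comp (measurable_shift _)) (hτ.comp (measurable_shift _)) hv)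

theorem loynesState_of_solution {V : Ω → OrderedVec p} {ω : Ω}
    (hV : ∀ n, V (θ (shift θ n ω)) =
      lossMap (σ (shift θ n ω)) (τ (shift θ n ω)) (V (shift θ n ω))) (n : ℕ) :
    loynesState θ σ τ ω n (V (shift θ (-(n : ℤ)) ω)) = V ω := by
  induction n with
  | zero => rfl
  | succ n ih => rw [loynesState, ← hV, apply_shift_neg_succ, ih]

theorem DominatedByZ.loynesState {ω : Ω} (hτ : ∀ n, 0 ≤ τ (shift θ n ω)) (n : ℕ)
    {v : OrderedVec p} (hv : DominatedByZ θ σ τ (shift θ (-(n : ℤ)) ω) v) :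
    DominatedByZ θ σ τ ω (loynesState θ σ τ ω n v) := by
  induction n generalizing v with
  | zero => exact hv
  | succ n ih =>
    have h := hv.lossMap (hτ _)
    rw [apply_shift_neg_succ] at h
    exact ih h

theorem loynesState_le_max_Z_one {ω : Ω} (hτ : ∀ n, 0 ≤ τ (shift θ n ω)) (n : ℕ)
    {v : OrderedVec p} {c : ℝ}
    (hv : ∀ j, (v.1 j : EReal) ≤ max (Z θ σ τ 1 (shift θ (-(n : ℤ)) ω)) c) (i : Fin p) :
    ((loynesState θ σ τ ω n v).1 i : EReal) ≤ max (Z θ σ τ 1 ω)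
      ((c - ∑ i ∈ Finset.Icc 1 n, τ (shift θ (-(i : ℤ)) ω) : ℝ) : EReal) := by
  induction n generalizing v c with
  | zero => simpa [loynesState] using hv i
  | succ n ih =>
    have h := lossMap_le_max_Z_one (hτ _) hv
    rw [apply_shift_neg_succ] at h
    refine (ih h).trans_eq ?_
    rw [Finset.sum_Icc_succ_top (by omega), sub_sub,
      add_comm (τ (shift θ (-((n + 1 : ℕ) : ℤ)) ω))]

theorem loynesState_eq_zero {ω : Ω} (hτ : ∀ n, 0 ≤ τ (shift θ n ω)) (hZ : Z θ σ τ 1 ω = 0)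
    (n : ℕ) : loynesState θ σ τ ω n (0 : OrderedVec p) = 0 := by
  refine orderedVec_eq_zero fun i => ?_
  have h := (DominatedByZ.loynesState (σ := σ) hτ n (dominatedByZ_zero (p := p) _)).le_Z_one i
  rw [hZ] at h
  exact_mod_cast h

theorem loynesState_add_eq {ω : Ω} (hτ : ∀ n, 0 ≤ τ (shift θ n ω)) {n : ℕ}
    (hZ : Z θ σ τ 1 (shift θ (-(n : ℤ)) ω) = 0) (k : ℕ) :
    loynesState θ σ τ ω (n + k) (0 : OrderedVec p) = loynesState θ σ τ ω n 0 := by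
  rw [loynesState_add, loynesState_eq_zero (fun m => ?_) hZ]
  rw [← shift_add]
  exact hτ _

theorem loynesState_eq_of_Z_eq_zero {ω : Ω} (hτ : ∀ n, 0 ≤ τ (shift θ n ω)) {m n : ℕ}
    (hm : Z θ σ τ 1 (shift θ (-(m : ℤ)) ω) = 0) (hn : Z θ σ τ 1 (shift θ (-(n : ℤ)) ω) = 0) :
    loynesState θ σ τ ω m (0 : OrderedVec p) = loynesState θ σ τ ω n 0 := by
  rw [← loynesState_add_eq hτ hm n, ← loynesState_add_eq hτ hn m, add_comm]

/-- A measurable choice of the profile obtained by starting the system empty at a past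
regeneration time `-n`, i.e. one with `Z_1 ∘ θ^{-n} = 0`. -/
theorem exists_measurable_loynes_limit (hσ : Measurable σ) (hτ : Measurable τ) :
    ∃ U : Ω → OrderedVec p, Measurable U ∧ ∀ ω, (∀ n, 0 ≤ τ (shift θ n ω)) →
      ∀ n : ℕ, Z θ σ τ 1 (shift θ (-(n : ℤ)) ω) = 0 → U ω = loynesState θ σ τ ω n 0 := by
  classical
  let q (n : ℕ) (ω : Ω) : Prop := Z θ σ τ 1 (shift θ (-(n : ℤ)) ω) = 0
  have hq (n : ℕ) : MeasurableSet {ω | q n ω} :=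
    measurable_shift _ (measurableSet_Z_eq_zero hσ hτ 1)
  let r (n : ℕ) (ω : Ω) : Prop := q n ω ∨ ∀ m, ¬ q m ω
  have hr (n : ℕ) : MeasurableSet {ω | r n ω} := by
    refine (hq n).union (?_ : MeasurableSet {ω | ∀ m, ¬ q m ω})
    rw [Set.ofPred_forall]
    exact .iInter fun m => (hq m).compl
  have hex (ω : Ω) : ∃ n, r n ω := by
    by_cases h : ∃ n, q n ω
    · exact h.imp fun _ => Or.inl
    · exact ⟨0, Or.inr (not_exists.1 h)⟩
  refine ⟨fun ω => loynesState θ σ τ ω (Nat.find (hex ω)) 0,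
    Measurable.find (f := fun n ω => loynesState θ σ τ ω n 0)
      (fun n => measurable_loynesState hσ hτ n measurable_const) hr hex, ?_⟩
  intro ω hω n hn
  rcases Nat.find_spec (hex ω) with h | h
  · exact loynesState_eq_of_Z_eq_zero hω h hn
  · exact absurd hn (h n)

/-- Every stationary profile is bounded by `Z_1`. -/
theorem IsStationarySolution.ae_le_Z_one {P : Measure Ω} [IsProbabilityMeasure P]
    (hθ : Ergodic θ P) (hτm : Measurable τ) (hτ0 : ∀ᵐ ω ∂P, 0 ≤ τ ω)
    (hτ1 : P {ω | 1 < τ ω} ≠ 0) {V : Ω → OrderedVec p} (hV : IsStationarySolution P θ σ τ V) :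
    ∀ᵐ ω ∂P, ∀ i, ((V ω).1 i : EReal) ≤ Z θ σ τ 1 ω := by
  have hVm (i : Fin p) : Measurable fun ω => (V ω).1 i :=
    (measurable_pi_apply i).comp (measurable_subtype_coe.comp hV.1)
  obtain ⟨M, hM⟩ : ∃ M : ℕ, P {ω | ∀ i, (V ω).1 i ≤ M} ≠ 0 := by
    by_contra! h
    have hU : (⋃ M : ℕ, {ω | ∀ i, (V ω).1 i ≤ M}) = Set.univ := by
      refine Set.eq_univ_of_forall fun ω => Set.mem_iUnion.2 ?_
      obtain ⟨c, hc⟩ := Finite.bddAbove_range (V ω).1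
      obtain ⟨M, hM⟩ := exists_nat_ge c
      exact ⟨M, fun i => (hc ⟨i, rfl⟩).trans hM⟩
    have h0 := measure_iUnion_null h
    rw [hU, measure_univ] at h0
    exact one_ne_zero h0
  have hMm : MeasurableSet {ω | ∀ i, (V ω).1 i ≤ M} := by
    rw [Set.ofPred_forall]
    exact .iInter fun i => hVm i measurableSet_Iic
  filter_upwards [ae_frequently_shift_neg_mem hθ hMm hM,
    ae_tendsto_sum_shift_neg hθ hτm hτ0 hτ1, ae_forall_shift hθ.toMeasurePreserving hτ0,
    ae_forall_shift hθ.toMeasurePreserving hV.2] with ω hfreq hsum hpos hsol i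
  obtain ⟨n, hn, hle⟩ := (hfreq.and_eventually (hsum.eventually_ge_atTop (M : ℝ))).exists
  have h := loynesState_le_max_Z_one (σ := σ) hpos n (v := V (shift θ (-(n : ℤ)) ω)) (c := M)
    (fun j => le_trans (by exact_mod_cast hn j) (le_max_right _ _)) i
  rw [loynesState_of_solution hsol] at h
  refine h.trans (max_le le_rfl (le_trans ?_ (Z_nonneg _ _)))
  exact_mod_cast sub_nonpos.2 hle

end Loynes

section Positivity

variable {Ω : Type*} [MeasurableSpace Ω] {P : Measure Ω}

theorem indepFun_prodMk_left {α β γ : Type*} [MeasurableSpace α] [MeasurableSpace β]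
    [MeasurableSpace γ] [IsFiniteMeasure P] {X : Ω → α} {Y : Ω → β} {W : Ω → γ}
    (hX : Measurable X) (hY : Measurable Y) (hW : Measurable W)
    (h : IndepFun X (fun ω => (Y ω, W ω)) P) (hYW : IndepFun Y W P) :
    IndepFun (fun ω => (X ω, Y ω)) W P := by
  have hXY : IndepFun X Y P := h.comp measurable_id measurable_fst
  rw [indepFun_iff_map_prod_eq_prod_map_map (hX.prodMk hY).aemeasurable hW.aemeasurable,
    hXY.map_prod_eq_prod_map_map hX.aemeasurable hY.aemeasurable,
    ← MeasurableEquiv.prodAssoc.map_measurableEquiv_injective.eq_iff, Measure.prodAssoc_prod,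
    ← hYW.map_prod_eq_prod_map_map hY.aemeasurable hW.aemeasurable,
    ← h.map_prod_eq_prod_map_map hX.aemeasurable (hY.prodMk hW).aemeasurable,
    Measure.map_map MeasurableEquiv.prodAssoc.measurable ((hX.prodMk hY).prodMk hW)]
  rfl

variable {θ : Ω ≃ᵐ Ω} {σ τ : Ω → ℝ}

/-- The current inter-arrival time is independent of the service times and of the past
inter-arrival times. -/
theorem IsGIGI.indepFun_past [IsProbabilityMeasure P] (hσ : Measurable σ) (hτ : Measurable τ)
    (h : IsGIGI P θ σ τ) :
    IndepFun (fun ω => ((fun n : ℤ => σ (shift θ n ω)),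
      (fun n : ℕ => τ (shift θ (-((n + 1 : ℕ) : ℤ)) ω)))) τ P := by
  have hτs (n : ℤ) : Measurable fun ω => τ (shift θ n ω) := hτ.comp (measurable_shift n)
  refine indepFun_prodMk_left (measurable_pi_lambda _ fun n => hσ.comp (measurable_shift n))
    (measurable_pi_lambda _ fun n => hτs _) hτ ?_ ?_
  · exact h.2.2.comp (φ := id)
      (ψ := fun x : ℤ → ℝ => ((fun n : ℕ => x (-((n + 1 : ℕ) : ℤ))), x 0)) measurable_id
      (by fun_prop)
  · have hi := indep_iSup_of_disjoint (fun n => (hτs n).comap_le) h.2.1.1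
      (S := Set.Iio 0) (T := {0}) (by simp)
    refine indep_of_indep_of_le_left (indep_of_indep_of_le_right hi ?_) ?_
    · exact le_iSup₂_of_le 0 rfl le_rfl
    · simp only [MeasurableSpace.pi, MeasurableSpace.comap_iSup, MeasurableSpace.comap_comp]
      exact iSup_le fun n => le_iSup₂_of_le (-((n + 1 : ℕ) : ℤ)) (by simp; omega) le_rfl

theorem measure_lt_ne_zero_of_not_isBounded_support (hτm : Measurable τ)
    (hτ0 : ∀ᵐ ω ∂P, 0 ≤ τ ω) (hτu : ¬ Bornology.IsBounded (P.map τ).support) (M : ℝ) :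
    P {ω | M < τ ω} ≠ 0 := by
  intro h
  refine hτu ((Metric.isBounded_Icc 0 M).subset
    (Measure.support_subset_of_isClosed isClosed_Icc ?_))
  refine (ae_map_iff hτm.aemeasurable (p := (· ∈ Set.Icc 0 M)) measurableSet_Icc).2 ?_
  filter_upwards [hτ0, measure_eq_zero_iff_ae_notMem.1 h] with ω h0 h1
  exact ⟨h0, not_lt.1 h1⟩

/-- If `Z_ℓ` is finite with positive probability, and the inter-arrival times are unbounded, then
`Z_1` vanishes with positive probability. -/
theorem IsGIGI.measure_Z_one_eq_zero_ne_zero [IsProbabilityMeasure P]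
    (hθ : MeasurePreserving θ P P) (hσ : Measurable σ) (hτ : Measurable τ)
    (h : IsGIGI P θ σ τ) (hτM : ∀ M : ℝ, P {ω | M < τ ω} ≠ 0) {ℓ : ℕ}
    (hZ : P {ω | Z θ σ τ ℓ ω = 0} ≠ 0) : P {ω | Z θ σ τ 1 ω = 0} ≠ 0 := by
  let E (M : ℕ) : Set Ω := {ω | ∀ k, residual θ σ τ k ω ≤ M}
  obtain ⟨M, hM⟩ : ∃ M, P (E M) ≠ 0 := by
    by_contra! hE
    refine hZ (measure_mono_null (fun ω hω => ?_) (measure_iUnion_null hE))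
    obtain ⟨c, hc⟩ := ((Finset.range ℓ).image fun k => residual θ σ τ k ω).bddAbove
    obtain ⟨M, hM⟩ := exists_nat_ge c
    refine Set.mem_iUnion.2 ⟨M, fun k => ?_⟩
    rcases lt_or_ge k ℓ with hk | hk
    · exact (hc (by simpa using ⟨k, hk, rfl⟩)).trans hM
    · exact (Z_eq_zero_iff.1 hω k hk).trans M.cast_nonneg
  let F : Set ((ℤ → ℝ) × (ℕ → ℝ)) :=
    {x | ∀ k : ℕ, x.1 (-(k : ℤ)) - ∑ i ∈ Finset.range k, x.2 i ≤ M}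
  have hF : MeasurableSet F := by
    simp only [F, Set.ofPred_forall]
    exact .iInter fun k => measurableSet_le (by fun_prop) measurable_const
  have hEF : E M = (fun ω => ((fun n : ℤ => σ (shift θ n ω)),
      (fun n : ℕ => τ (shift θ (-((n + 1 : ℕ) : ℤ)) ω)))) ⁻¹' F := by
    ext ω
    refine forall_congr' fun k => ?_
    rw [residual, Finset.range_eq_Ico, Finset.sum_Ico_add' (fun i : ℕ => τ (shift θ (-(i : ℤ)) ω))]
    rfl
  have hind := (h.indepFun_past hσ hτ).measure_inter_preimage_eq_mul F (Set.Ioi (M : ℝ)) hF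
    measurableSet_Ioi
  rw [← hEF] at hind
  have hpos : P (E M ∩ τ ⁻¹' Set.Ioi (M : ℝ)) ≠ 0 := by
    rw [hind]
    exact mul_ne_zero hM (hτM M)
  rw [← hθ.measure_preimage (measurableSet_Z_eq_zero hσ hτ 1).nullMeasurableSet]
  refine fun h0 => hpos (measure_mono_null (fun ω hω => ?_) h0)
  refine Z_eq_zero_iff.2 fun k hk => ?_
  obtain ⟨k, rfl⟩ := Nat.exists_eq_add_of_le' hk
  rw [residual_succ_apply]
  exact sub_nonpos.2 ((hω.1 k).trans (le_of_lt hω.2))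

end Positivity

end LossSystem

theorem theorem2 {Ω : Type*} [MeasurableSpace Ω] (P : Measure Ω) [IsProbabilityMeasure P]
    (θ : Ω ≃ᵐ Ω) (hθ : Ergodic θ P)
    (σ τ : Ω → ℝ) (hσm : Measurable σ) (hτm : Measurable τ)
    (hσ0 : ∀ᵐ ω ∂P, 0 ≤ σ ω) (hτ0 : ∀ᵐ ω ∂P, 0 < τ ω)
    (hσi : Integrable σ P) (hτi : Integrable τ P)
    (hGI : LossSystem.IsGIGI P θ σ τ)
    (hτu : ¬ Bornology.IsBounded (P.map τ).support)
    (p : ℕ) [NeZero p]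
    (hZ : 0 < P {ω | LossSystem.Z θ σ τ p ω = 0}) :
    ∃ U : Ω → LossSystem.OrderedVec p,
      LossSystem.IsStationarySolution P θ σ τ U ∧
      (∀ V : Ω → LossSystem.OrderedVec p,
        LossSystem.IsStationarySolution P θ σ τ V → V =ᵐ[P] U) ∧
      (∀ᵐ ω ∂P, ∀ i : Fin p,
        (((U ω).1 i : ℝ) : EReal) ≤ LossSystem.Z θ σ τ (p - (i : ℕ)) ω) := by
  have hτ0' : ∀ᵐ ω ∂P, 0 ≤ τ ω := hτ0.mono fun _ h => h.le
  have hτM := LossSystem.measure_lt_ne_zero_of_not_isBounded_support hτm hτ0' hτu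
  have hA := hGI.measure_Z_one_eq_zero_ne_zero hθ.toMeasurePreserving hσm hτm hτM hZ.ne'
  have hrec := LossSystem.ae_frequently_shift_neg_mem hθ
    (LossSystem.measurableSet_Z_eq_zero hσm hτm 1) hA
  have hpos := LossSystem.ae_forall_shift hθ.toMeasurePreserving hτ0'
  obtain ⟨U, hUm, hU⟩ := LossSystem.exists_measurable_loynes_limit (p := p) (θ := θ) hσm hτm
  refine ⟨U, ⟨hUm, ?_⟩, fun V hV => ?_, ?_⟩
  · filter_upwards [hrec, hpos] with ω hfreq hω
    obtain ⟨n, hn⟩ := hfreq.exists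
    rw [hU ω hω n hn, hU (θ ω) (fun m => ?_) (n + 1) ?_, LossSystem.loynesState_succ_apply]
    · rw [LossSystem.shift_neg_succ_apply]
      exact hn
    · rw [LossSystem.shift_apply]
      exact hω _
  · filter_upwards [hrec, hpos, LossSystem.ae_forall_shift hθ.toMeasurePreserving hV.2,
      LossSystem.ae_forall_shift hθ.toMeasurePreserving
        (hV.ae_le_Z_one hθ hτm hτ0' (hτM 1))] with ω hfreq hω hsol hle
    obtain ⟨n, hn⟩ := hfreq.exists
    have hV0 : V (LossSystem.shift θ (-(n : ℤ)) ω) = 0 := by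
      refine LossSystem.orderedVec_eq_zero fun i => ?_
      exact_mod_cast (hle _ i).trans (le_of_eq hn)
    rw [hU ω hω n hn, ← LossSystem.loynesState_of_solution hsol n, hV0]
  · filter_upwards [hrec, hpos] with ω hfreq hω
    obtain ⟨n, hn⟩ := hfreq.exists
    rw [hU ω hω n hn]
    exact LossSystem.DominatedByZ.loynesState hω n (LossSystem.dominatedByZ_zero _)
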